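/- **Theorem 3.5 (Partial semigroup property of Caputo fractional differential operators).** Let $-\infty<a<b<\infty$; all functions are real-valued on $[a,b]$, and derivatives at $a$ and $b$ are one-sided. For $\alpha>0$ and $g\in C[a,b]$ put $J_a^\alpha g(x)=\frac1{\Gamma(\alpha)}\int_a^x(x-t)^{\alpha-1}g(t)\,dt$, and let $J_a^0$ be the identity. For $\alpha>0$, $m=\lceil\alpha\rceil$ and $f\in C^{m-1}[a,b]$ let $T_{m-1}[f;a](t)=\sum_{k=0}^{m-1}\frac{f^{(k)}(a)}{k!}(t-a)^k$. Such an $f$ is called *continuously Caputo $\alpha$-differentiable* if the Caputo derivative ${}^{C}\!D_a^\alpha f:=D^mJ_a^{m-\alpha}\bigl(f-T_{m-1}[f;a]\bigr)$ exists and is continuous on $[a,b]$, i.e. if $J_a^{m-\alpha}(f-T_{m-1}[f;a])\in C^m[a,b]$. **I.** Let $\alpha>0$ and let $f\in C^{\lceil\alpha\rceil-1}[a,b]$ be continuously Caputo $\alpha$-differentiable. Then for every $0<\beta<\alpha$: (i) $f$ is continuously Caputo $\beta$-differentiable, with continuous derivative $f_1:={}^{C}\!D_a^\beta f\in C[a,b]$;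 furthermore, if $\beta\notin\mathbb N$, then $({}^{C}\!D_a^\beta f)(a)=0$. (ii) For every $0<\gamma\le1$ with $\beta+\gamma\le\alpha$ and $\lceil\beta+\gamma\rceil-\lfloor\beta\rfloor=1$, the function $f_1$ is continuously Caputo $\gamma$-differentiable and ${}^{C}\!D_a^\gamma f_1={}^{C}\!D_a^{\beta+\gamma}f$ on $[a,b]$, i.e. ${}^{C}\!D_a^\gamma\,{}^{C}\!D_a^\beta f={}^{C}\!D_a^{\beta+\gamma}f$. **II.** Conversely, let $\beta>0$ and $0<\gamma\le1$ be such that $\lceil\beta+\gamma\rceil-\lfloor\beta\rfloor=1$. Assume that $h\in C^{\lceil\beta\rceil-1}[a,b]$ is continuously Caputo $\beta$-differentiable, that $h_1:={}^{C}\!D_a^\beta h$ is continuously Caputo $\gamma$-differentiable, and that $h_1(a)=0$ if $\beta\notin\mathbb N$. Then $h$ is continuously Caputo $(\beta+\gamma)$-differentiable and ${}^{C}\!D_a^\gamma h_1={}^{C}\!D_a^{\beta+\gamma}h$ on $[a,b]$, i.e. ${}^{C}\!D_a^\gamma({}^{C}\!D_a^\beta h)={}^{C}\!D_a^{\beta+\gamma}h$.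 -/

import Mathlib

noncomputable section

/-- The Riemann-Liouville fractional integral `J_a^α f` of order `α ≥ 0` with base point `a`;
`J_a^0` is the identity. -/
def rlIntegral (a α : ℝ) (f : ℝ → ℝ) (x : ℝ) : ℝ :=
  open Classical in
  if α = 0 then f x
  else 1 / Real.Gamma α * ∫ t in a..x, (x - t) ^ (α - 1) * f t

/-- The Riemann-Liouville derivative `D^m J_a^{m-α} f` on `[a,b]`, with `m = ⌈α⌉`
(one-sided derivatives at the endpoints). -/
def rlDeriv (a b α : ℝ) (f : ℝ → ℝ) : ℝ → ℝ :=
  iteratedDerivWithin ⌈α⌉₊ (rlIntegral a ((⌈α⌉₊ : ℝ) - α) f) (Set.Icc a b)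

/-- `f` is continuously Riemann-Liouville `α`-differentiable on `[a,b]`: `f ∈ C[a,b]`, and
`D^m J_a^{m-α} f` exists and is continuous on `[a,b]`, that is, `J_a^{m-α} f ∈ C^m[a,b]`,
with `m = ⌈α⌉`. -/
def ContRLDifferentiable (a b α : ℝ) (f : ℝ → ℝ) : Prop :=
  ContinuousOn f (Set.Icc a b) ∧
    ContDiffOn ℝ (⌈α⌉₊ : ℕ) (rlIntegral a ((⌈α⌉₊ : ℝ) - α) f) (Set.Icc a b)

/-- The remainder `f - T_{m-1}[f;a]`, where `m = ⌈α⌉` and `T_{m-1}[f;a]` is the Taylor polynomial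
of `f` of degree `m - 1` at `a` (for `α > 0`, so that `m ≥ 1`). -/
def caputoRemainder (a b α : ℝ) (f : ℝ → ℝ) (t : ℝ) : ℝ :=
  f t - taylorWithinEval f (⌈α⌉₊ - 1) (Set.Icc a b) a t

/-- The Caputo derivative of order `α ≥ 0` on `[a,b]`: the Riemann-Liouville derivative of
`f - T_{m-1}[f;a]` for `α > 0`, and `f` itself for `α = 0`. -/
def caputoDeriv (a b α : ℝ) (f : ℝ → ℝ) : ℝ → ℝ :=
  open Classical in
  if α = 0 then f else rlDeriv a b α (caputoRemainder a b α f)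

/-- `f` is continuously Caputo `α`-differentiable on `[a,b]` (for `α > 0`): `f ∈ C^{⌈α⌉-1}[a,b]`,
and the Caputo derivative of order `α` of `f` exists and is continuous on `[a,b]`. -/
def ContCaputoDifferentiable (a b α : ℝ) (f : ℝ → ℝ) : Prop :=
  ContDiffOn ℝ (⌈α⌉₊ - 1 : ℕ) f (Set.Icc a b) ∧
    ContRLDifferentiable a b α (caputoRemainder a b α f)

end

open Set MeasureTheory Filter Topology

/-! Everything rests on a characterisation: with `m = ⌈α⌉`, `f` is continuously Caputo
`α`-differentiable exactly when `f = ∑_{j<m} c_j (x-a)^j / j! + J_a^α g` on `[a,b]` with `g`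
continuous, and then `g` is the Caputo derivative (`contCaputoDifferentiable_of_eqOn_fracTaylor`,
`ContCaputoDifferentiable.eqOn_fracTaylor`). It turns every claim into algebra with `J_a^α J_a^β =
J_a^{α+β}` (`rlIntegral_rlIntegral`).

To lower the order to `β`, write the remainder as `J_a^β` of a continuous function, itself a
fractional integral, which vanishes at `a` when its order is positive.

For composition, the ceiling condition leaves two cases. If `β` is not an integer, `β` and `β + γ`
have the same ceiling, the polynomials agree, and `f₁ = J_a^γ g`. If `β = n`, the polynomial of
order `n + γ` has one more term, and `(x-a)^n / n! = J_a^n 1` moves it into the integrand, so `f₁ =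
c_n + J_a^γ g`. The converse reads this backwards; for noninteger `β` there is no room for a
constant, hence the condition `h₁(a) = 0`. -/

/-! ### Elementary properties of the Riemann-Liouville integral. -/

theorem rlIntegral_zero (a : ℝ) (f : ℝ → ℝ) : rlIntegral a 0 f = f := by
  funext x; simp [rlIntegral]

theorem rlIntegral_of_pos {a α : ℝ} (hα : 0 < α) (f : ℝ → ℝ) (x : ℝ) :
    rlIntegral a α f x = 1 / Real.Gamma α * ∫ t in a..x, (x - t) ^ (α - 1) * f t := by
  simp [rlIntegral, hα.ne']

theorem rlIntegral_self {a α : ℝ} (hα : 0 < α) (f : ℝ → ℝ) : rlIntegral a α f a = 0 := by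
  simp [rlIntegral_of_pos hα]

theorem rlIntegral_one (a : ℝ) (f : ℝ → ℝ) (x : ℝ) :
    rlIntegral a 1 f x = ∫ t in a..x, f t := by
  simp [rlIntegral]

/-- The values of `J_a^α f` on `[a,b]` depend only on the values of `f` on `[a,b]`. -/
theorem rlIntegral_congr {a b : ℝ} {f g : ℝ → ℝ} (h : EqOn f g (Icc a b)) (α : ℝ) :
    EqOn (rlIntegral a α f) (rlIntegral a α g) (Icc a b) := by
  intro x hx
  unfold rlIntegral
  split_ifs
  · exact h hx
  · congr 1
    refine intervalIntegral.integral_congr fun t ht => ?_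
    rw [uIcc_of_le hx.1] at ht
    simp only [h ⟨ht.1, ht.2.trans hx.2⟩]

/-- Any function continuous on `[a,b]` agrees there with a continuous function on the line. -/
theorem exists_continuous_eqOn_Icc {a b : ℝ} (hab : a ≤ b) {f : ℝ → ℝ}
    (hf : ContinuousOn f (Icc a b)) : ∃ g : ℝ → ℝ, Continuous g ∧ EqOn f g (Icc a b) :=
  ⟨IccExtend hab ((Icc a b).domRestrict f), (continuousOn_iff_continuous_domRestrict.1 hf).Icc_extend',
    fun x hx => by rw [IccExtend_of_mem hab _ hx]; rfl⟩

theorem intervalIntegrable_sub_rpow {a x r : ℝ} (hr : -1 < r) :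
    IntervalIntegrable (fun t => (x - t) ^ r) volume a x := by
  have := (intervalIntegral.intervalIntegrable_rpow' (a := x - a) (b := 0) hr).comp_sub_left x
  simpa using this

theorem intervalIntegrable_sub_rpow_mul {a b α : ℝ} (hα : 0 < α) {f : ℝ → ℝ}
    (hf : ContinuousOn f (Icc a b)) {x : ℝ} (hx : x ∈ Icc a b) :
    IntervalIntegrable (fun t => (x - t) ^ (α - 1) * f t) volume a x := by
  refine (intervalIntegrable_sub_rpow (by linarith)).mul_continuousOn ?_
  rw [uIcc_of_le hx.1]
  exact hf.mono (Icc_subset_Icc_right hx.2)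

theorem rlIntegral_add {a b α : ℝ} (hα : 0 ≤ α) {f g : ℝ → ℝ} (hf : ContinuousOn f (Icc a b))
    (hg : ContinuousOn g (Icc a b)) {x : ℝ} (hx : x ∈ Icc a b) :
    rlIntegral a α (fun t => f t + g t) x = rlIntegral a α f x + rlIntegral a α g x := by
  rcases hα.eq_or_lt with rfl | hα
  · simp [rlIntegral_zero]
  · simp only [rlIntegral_of_pos hα, mul_add]
    rw [intervalIntegral.integral_add (intervalIntegrable_sub_rpow_mul hα hf hx)
      (intervalIntegrable_sub_rpow_mul hα hg hx), mul_add]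

theorem rlIntegral_sub {a b α : ℝ} (hα : 0 ≤ α) {f g : ℝ → ℝ} (hf : ContinuousOn f (Icc a b))
    (hg : ContinuousOn g (Icc a b)) {x : ℝ} (hx : x ∈ Icc a b) :
    rlIntegral a α (fun t => f t - g t) x = rlIntegral a α f x - rlIntegral a α g x := by
  rcases hα.eq_or_lt with rfl | hα
  · simp [rlIntegral_zero]
  · simp only [rlIntegral_of_pos hα, mul_sub]
    rw [intervalIntegral.integral_sub (intervalIntegrable_sub_rpow_mul hα hf hx)
      (intervalIntegrable_sub_rpow_mul hα hg hx), mul_sub]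

theorem rlIntegral_natCast_const (a : ℝ) (n : ℕ) (c x : ℝ) :
    rlIntegral a n (fun _ => c) x = c / n.factorial * (x - a) ^ n := by
  rcases n with _ | n
  · simp [rlIntegral_zero]
  · rw [rlIntegral_of_pos (by positivity)]
    have h : ∀ t : ℝ, (x - t) ^ (((n + 1 : ℕ) : ℝ) - 1) * c = (x - t) ^ n * c := fun t => by
      rw [← Real.rpow_natCast]; simp
    simp only [h]
    rw [intervalIntegral.integral_mul_const,
      intervalIntegral.integral_comp_sub_left (fun t => t ^ n) x, integral_pow]
    push_cast
    rw [Real.Gamma_nat_eq_factorial, Nat.factorial_succ]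
    push_cast
    have : (n.factorial : ℝ) ≠ 0 := by positivity
    field_simp
    simp

/-! ### Continuity of the fractional integral. -/

/-- The fractional integral, rescaled to the unit interval. -/
theorem rlIntegral_eq_rescaled {a α x : ℝ} (hα : 0 < α) (hx : a ≤ x) (f : ℝ → ℝ) :
    rlIntegral a α f x = (x - a) ^ α * (1 / Real.Gamma α *
      ∫ s in (0 : ℝ)..1, (1 - s) ^ (α - 1) * f ((x - a) * s + a)) := by
  rcases hx.eq_or_lt with rfl | hx
  · simp [rlIntegral_self hα, Real.zero_rpow hα.ne']
  have hp : 0 < x - a := sub_pos.2 hx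
  have h := intervalIntegral.integral_comp_mul_add (a := 0) (b := 1)
    (fun t => (x - t) ^ (α - 1) * f t) hp.ne' a
  simp only [mul_zero, zero_add, mul_one, sub_add_cancel, smul_eq_mul] at h
  have h2 : ∫ s in (0 : ℝ)..1, (x - ((x - a) * s + a)) ^ (α - 1) * f ((x - a) * s + a)
      = (x - a) ^ (α - 1) * ∫ s in (0 : ℝ)..1, (1 - s) ^ (α - 1) * f ((x - a) * s + a) := by
    rw [← intervalIntegral.integral_const_mul]
    refine intervalIntegral.integral_congr fun s hs => ?_
    rw [uIcc_of_le zero_le_one] at hs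
    have : x - ((x - a) * s + a) = (x - a) * (1 - s) := by ring
    simp only [this]
    rw [Real.mul_rpow hp.le (by linarith [hs.2])]
    ring
  rw [h2, eq_comm, inv_mul_eq_iff_eq_mul₀ hp.ne'] at h
  rw [rlIntegral_of_pos hα, h, Real.rpow_sub_one hp.ne']
  field_simp

/-- After rescaling, neither the singular weight nor the interval of integration depends on `x`, so
dominated convergence applies with bound `M (1 - s)^(α - 1)`. -/
theorem continuousOn_rlIntegral {a b α : ℝ} (hα : 0 ≤ α) {f : ℝ → ℝ}
    (hf : ContinuousOn f (Icc a b)) : ContinuousOn (rlIntegral a α f) (Icc a b) := by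
  rcases hα.eq_or_lt with rfl | hα
  · rwa [rlIntegral_zero]
  rcases lt_or_ge b a with hab | hab
  · simp [Icc_eq_empty_of_lt hab]
  obtain ⟨M, hM⟩ := isCompact_Icc.exists_bound_of_continuousOn hf
  refine ContinuousOn.congr ?_ fun x hx => rlIntegral_eq_rescaled hα hx.1 f
  refine ((continuousOn_id.sub continuousOn_const).rpow_const fun _ _ => Or.inr hα.le).mul
    (continuousOn_const.mul ?_)
  have hmem : ∀ x ∈ Icc a b, ∀ s ∈ Icc (0 : ℝ) 1, (x - a) * s + a ∈ Icc a b := by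
    rintro x ⟨h1, h2⟩ s ⟨h3, h4⟩
    constructor <;> nlinarith
  intro x hx
  refine intervalIntegral.continuousWithinAt_of_dominated_interval
    (bound := fun s => (1 - s) ^ (α - 1) * M) ?_ ?_ ?_ ?_
  · filter_upwards [self_mem_nhdsWithin] with y hy
    refine AEStronglyMeasurable.mul
      (Measurable.pow_const (by fun_prop) _).aestronglyMeasurable ?_
    refine ContinuousOn.aestronglyMeasurable (hf.comp (by fun_prop) ?_) measurableSet_uIoc
    intro s hs
    rw [uIoc_of_le zero_le_one] at hs
    exact hmem y hy s ⟨hs.1.le, hs.2⟩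
  · filter_upwards [self_mem_nhdsWithin] with y hy
    refine Eventually.of_forall fun s hs => ?_
    rw [uIoc_of_le zero_le_one] at hs
    have h1 : 0 ≤ 1 - s := by linarith [hs.2]
    rw [norm_mul, Real.norm_of_nonneg (Real.rpow_nonneg h1 _)]
    exact mul_le_mul_of_nonneg_left (hM _ (hmem y hy s ⟨hs.1.le, hs.2⟩)) (Real.rpow_nonneg h1 _)
  · exact (intervalIntegrable_sub_rpow (by linarith)).mul_const M
  · refine Eventually.of_forall fun s hs => ?_
    rw [uIoc_of_le zero_le_one] at hs
    refine continuousWithinAt_const.mul ?_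
    refine ContinuousWithinAt.comp (t := Icc a b) (f := fun y => (y - a) * s + a)
      (hf _ (hmem x hx s ⟨hs.1.le, hs.2⟩)) (by fun_prop) ?_
    exact fun y hy => hmem y hy s ⟨hs.1.le, hs.2⟩

theorem hasDerivWithinAt_rlIntegral_one {a b : ℝ} {f : ℝ → ℝ} (hf : ContinuousOn f (Icc a b))
    {x : ℝ} (hx : x ∈ Icc a b) : HasDerivWithinAt (rlIntegral a 1 f) (f x) (Icc a b) x := by
  obtain ⟨g, hg, hfg⟩ := exists_continuous_eqOn_Icc (hx.1.trans hx.2) hf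
  have h := (hg.integral_hasStrictDerivAt a x).hasDerivAt.hasDerivWithinAt (s := Icc a b)
  rw [hfg hx]
  refine h.congr (fun y hy => ?_) ?_
  · rw [rlIntegral_congr hfg 1 hy, rlIntegral_one]
  · rw [rlIntegral_congr hfg 1 hx, rlIntegral_one]

/-! ### The Beta integral and the semigroup property. -/

theorem integral_beta_scaled {α β : ℝ} (hα : 0 < α) (hβ : 0 < β) {r : ℝ} (hr : 0 < r) :
    ∫ t in (0 : ℝ)..r, t ^ (α - 1) * (r - t) ^ (β - 1)
      = r ^ (α + β - 1) * (Real.Gamma α * Real.Gamma β / Real.Gamma (α + β)) := by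
  have h := Complex.betaIntegral_scaled α β hr
  rw [Complex.betaIntegral_eq_Gamma_mul_div _ _ (by simpa) (by simpa)] at h
  apply Complex.ofReal_injective
  rw [← intervalIntegral.integral_ofReal]
  calc _ = ∫ x in (0 : ℝ)..r, (x : ℂ) ^ ((α : ℂ) - 1) * ((r : ℂ) - x) ^ ((β : ℂ) - 1) := by
        refine intervalIntegral.integral_congr fun t ht => ?_
        rw [uIcc_of_le hr.le] at ht
        rw [Complex.ofReal_mul, Complex.ofReal_cpow ht.1, Complex.ofReal_cpow (sub_nonneg.2 ht.2)]
        push_cast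
        rfl
    _ = _ := by
        rw [h, ← Complex.ofReal_add, Complex.Gamma_ofReal, Complex.Gamma_ofReal,
          Complex.Gamma_ofReal, Complex.ofReal_mul, Complex.ofReal_cpow hr.le]
        push_cast
        rfl

theorem integral_sub_rpow_mul_sub_rpow {α β : ℝ} (hα : 0 < α) (hβ : 0 < β) {s x : ℝ}
    (hs : s < x) : ∫ t in s..x, (x - t) ^ (α - 1) * (t - s) ^ (β - 1)
      = (x - s) ^ (α + β - 1) * (Real.Gamma α * Real.Gamma β / Real.Gamma (α + β)) := by
  rw [← integral_beta_scaled hα hβ (sub_pos.2 hs)]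
  have := intervalIntegral.integral_comp_sub_left (a := s) (b := x)
    (fun t => t ^ (α - 1) * (x - s - t) ^ (β - 1)) x
  simp only [sub_self] at this
  rw [← this]
  refine intervalIntegral.integral_congr fun t _ => ?_
  congr 2
  ring

theorem intervalIntegrable_sub_rpow_mul_sub_rpow {α β : ℝ} (hα : 0 < α) (hβ : 0 < β) {s x : ℝ}
    (hs : s < x) :
    IntervalIntegrable (fun t => (x - t) ^ (α - 1) * (t - s) ^ (β - 1)) volume s x := by
  -- A nonintegrable function has integral `0` by convention, so the nonzero Beta value proves
  -- integrability.
  apply intervalIntegral.intervalIntegrable_of_integral_ne_zero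
  rw [integral_sub_rpow_mul_sub_rpow hα hβ hs]
  have := Real.Gamma_pos_of_pos hα
  have := Real.Gamma_pos_of_pos hβ
  have := Real.Gamma_pos_of_pos (add_pos hα hβ)
  have := Real.rpow_pos_of_pos (sub_pos.2 hs) (α + β - 1)
  positivity

/-- The integrand of the double integral over the triangle `a < s < t < x` that computes
`J_a^α J_a^β g`. -/
noncomputable def triangleKernel (α β x : ℝ) (g : ℝ → ℝ) (t s : ℝ) : ℝ :=
  (Ioi s).indicator (fun t => (x - t) ^ (α - 1) * (t - s) ^ (β - 1) * g s) t

theorem triangleKernel_eq_indicator_Iio (α β x : ℝ) (g : ℝ → ℝ) (t s : ℝ) :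
    triangleKernel α β x g t s =
      (Iio t).indicator (fun s => (x - t) ^ (α - 1) * ((t - s) ^ (β - 1) * g s)) s := by
  simp only [triangleKernel, indicator, mem_Ioi, mem_Iio, mul_assoc]

theorem setIntegral_triangleKernel_right {α β a x : ℝ} (g : ℝ → ℝ) {t : ℝ}
    (ht : t ∈ Ioc a x) : ∫ s in Ioc a x, triangleKernel α β x g t s =
      (x - t) ^ (α - 1) * ∫ s in a..t, (t - s) ^ (β - 1) * g s := by
  simp only [triangleKernel_eq_indicator_Iio]
  rw [setIntegral_indicator measurableSet_Iio, ← intervalIntegral.integral_const_mul,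
    intervalIntegral.integral_of_le ht.1.le, integral_Ioc_eq_integral_Ioo]
  congr 2
  ext s
  simp only [mem_inter_iff, mem_Ioc, mem_Iio, mem_Ioo]
  exact ⟨fun h => ⟨h.1.1, h.2⟩, fun h => ⟨⟨h.1, h.2.le.trans ht.2⟩, h.2⟩⟩

theorem Ioc_inter_Ioi_of_mem {a x s : ℝ} (hs : s ∈ Ioc a x) : Ioc a x ∩ Ioi s = Ioc s x := by
  ext t
  simp only [mem_inter_iff, mem_Ioc, mem_Ioi]
  exact ⟨fun h => ⟨h.2, h.1.2⟩, fun h => ⟨⟨hs.1.trans h.1, h.2⟩, h.1⟩⟩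

theorem setIntegral_triangleKernel_left {α β a x : ℝ} (hα : 0 < α) (hβ : 0 < β) (g : ℝ → ℝ)
    {s : ℝ} (hs : s ∈ Ioo a x) : ∫ t in Ioc a x, triangleKernel α β x g t s =
      (x - s) ^ (α + β - 1) * (Real.Gamma α * Real.Gamma β / Real.Gamma (α + β)) * g s := by
  simp only [triangleKernel]
  rw [setIntegral_indicator measurableSet_Ioi, Ioc_inter_Ioi_of_mem ⟨hs.1, hs.2.le⟩,
    ← intervalIntegral.integral_of_le hs.2.le, intervalIntegral.integral_mul_const,
    integral_sub_rpow_mul_sub_rpow hα hβ hs.2]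

theorem norm_triangleKernel {α β x : ℝ} (g : ℝ → ℝ) {t : ℝ} (ht : t ≤ x) (s : ℝ) :
    ‖triangleKernel α β x g t s‖ = triangleKernel α β x (fun s => ‖g s‖) t s := by
  simp only [triangleKernel, indicator, mem_Ioi]
  split_ifs with h
  · have h1 : 0 ≤ x - t := by linarith
    have h2 : 0 ≤ t - s := by linarith
    rw [norm_mul, Real.norm_of_nonneg (by positivity)]
  · simp

/-- Integrating the norm in `t` first gives a Beta integral; what remains is a constant times `(x -
s)^(α + β - 1) * ‖g s‖`, whose exponent exceeds `-1`. -/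
theorem integrable_triangleKernel {α β a x : ℝ} (hα : 0 < α) (hβ : 0 < β) (hx : a ≤ x)
    {g : ℝ → ℝ} (hg : Continuous g) :
    Integrable (Function.uncurry (triangleKernel α β x g))
      ((volume.restrict (Ioc a x)).prod (volume.restrict (Ioc a x))) := by
  have hmeas : Measurable (Function.uncurry (triangleKernel α β x g)) := by
    have : Function.uncurry (triangleKernel α β x g) = {p : ℝ × ℝ | p.2 < p.1}.indicator
        (fun p => (x - p.1) ^ (α - 1) * (p.1 - p.2) ^ (β - 1) * g p.2) := by
      funext p
      simp [Function.uncurry, triangleKernel, indicator]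
    rw [this]
    refine Measurable.indicator ?_ (measurableSet_lt measurable_snd measurable_fst)
    exact ((Measurable.pow_const (by fun_prop) _).mul (Measurable.pow_const (by fun_prop) _)).mul
      (hg.measurable.comp measurable_snd)
  have hae : ∀ᵐ s ∂(volume.restrict (Ioc a x)), s ∈ Ioo a x := by
    rw [← restrict_Ioo_eq_restrict_Ioc]
    exact ae_restrict_mem measurableSet_Ioo
  rw [integrable_prod_iff' hmeas.aestronglyMeasurable]
  constructor
  · filter_upwards [hae] with s hs
    simp only [Function.uncurry_apply_pair, triangleKernel]
    change IntegrableOn _ _ _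
    rw [IntegrableOn, integrable_indicator_iff measurableSet_Ioi, IntegrableOn,
      Measure.restrict_restrict measurableSet_Ioi, inter_comm,
      Ioc_inter_Ioi_of_mem ⟨hs.1, hs.2.le⟩]
    exact (((intervalIntegrable_iff_integrableOn_Ioc_of_le hs.2.le).1
      (intervalIntegrable_sub_rpow_mul_sub_rpow hα hβ hs.2))).mul_const _
  · have h : IntervalIntegrable (fun s => (x - s) ^ (α + β - 1) *
        (Real.Gamma α * Real.Gamma β / Real.Gamma (α + β)) * ‖g s‖) volume a x :=
      ((intervalIntegrable_sub_rpow (by linarith)).mul_const _).mul_continuousOn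
        hg.norm.continuousOn
    refine ((intervalIntegrable_iff_integrableOn_Ioc_of_le hx).1 h).congr ?_
    filter_upwards [hae] with s hs
    rw [← setIntegral_triangleKernel_left hα hβ (fun s => ‖g s‖) hs]
    refine setIntegral_congr_fun measurableSet_Ioc fun t ht => ?_
    exact (norm_triangleKernel g ht.2 s).symm

/-- The semigroup property of the Riemann-Liouville integrals. -/
theorem rlIntegral_rlIntegral {a b α β : ℝ} (hα : 0 ≤ α) (hβ : 0 ≤ β) {f : ℝ → ℝ}
    (hf : ContinuousOn f (Icc a b)) :
    EqOn (rlIntegral a α (rlIntegral a β f)) (rlIntegral a (α + β) f) (Icc a b) := by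
  rcases hα.eq_or_lt with rfl | hα
  · intro x _; rw [rlIntegral_zero, zero_add]
  rcases hβ.eq_or_lt with rfl | hβ
  · intro x _; rw [rlIntegral_zero, add_zero]
  intro x hx
  -- The extension `g` makes the kernel measurable on the whole plane, as Fubini requires.
  obtain ⟨g, hg, hfg⟩ := exists_continuous_eqOn_Icc (hx.1.trans hx.2) hf
  rw [rlIntegral_congr (rlIntegral_congr hfg β) α hx, rlIntegral_congr hfg _ hx]
  have hswap := integral_integral_swap (integrable_triangleKernel hα hβ hx.1 hg)
  rw [setIntegral_congr_fun measurableSet_Ioc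
      fun t ht => setIntegral_triangleKernel_right (α := α) (β := β) g ht] at hswap
  -- The Beta formula needs `s < x`, so the null endpoint `s = x` is removed and then restored.
  rw [integral_Ioc_eq_integral_Ioo (f := fun s => ∫ t in Ioc a x, triangleKernel α β x g t s),
    setIntegral_congr_fun measurableSet_Ioo
      fun s hs => setIntegral_triangleKernel_left hα hβ g hs, ← integral_Ioc_eq_integral_Ioo,
    ← intervalIntegral.integral_of_le hx.1, ← intervalIntegral.integral_of_le hx.1] at hswap
  rw [rlIntegral_of_pos hα, rlIntegral_of_pos (add_pos hα hβ)]
  simp only [rlIntegral_of_pos hβ]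
  have h1 : ∀ t, (x - t) ^ (α - 1) * (1 / Real.Gamma β * ∫ s in a..t, (t - s) ^ (β - 1) * g s) =
      1 / Real.Gamma β * ((x - t) ^ (α - 1) * ∫ s in a..t, (t - s) ^ (β - 1) * g s) :=
    fun t => by ring
  have h2 : ∀ s, (x - s) ^ (α + β - 1) *
        (Real.Gamma α * Real.Gamma β / Real.Gamma (α + β)) * g s =
      Real.Gamma α * Real.Gamma β / Real.Gamma (α + β) * ((x - s) ^ (α + β - 1) * g s) :=
    fun s => by ring
  simp only [h2] at hswap
  simp only [h1]
  rw [intervalIntegral.integral_const_mul, hswap, intervalIntegral.integral_const_mul]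
  have := Real.Gamma_pos_of_pos hα
  have := Real.Gamma_pos_of_pos hβ
  field_simp

/-! ### Injectivity and differentiation of fractional integrals. -/

/-- Applying `J_a^{1-α}` reduces to equal ordinary primitives, which are then differentiated. -/
theorem eqOn_of_rlIntegral_eqOn {a b α : ℝ} (hab : a < b) (hα : 0 ≤ α) (hα1 : α ≤ 1)
    {f g : ℝ → ℝ} (hf : ContinuousOn f (Icc a b)) (hg : ContinuousOn g (Icc a b))
    (h : EqOn (rlIntegral a α f) (rlIntegral a α g) (Icc a b)) : EqOn f g (Icc a b) := by
  have key : EqOn (rlIntegral a 1 f) (rlIntegral a 1 g) (Icc a b) := by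
    intro x hx
    have hf' := rlIntegral_rlIntegral (sub_nonneg.2 hα1) hα hf hx
    have hg' := rlIntegral_rlIntegral (sub_nonneg.2 hα1) hα hg hx
    rw [sub_add_cancel] at hf' hg'
    rw [← hf', ← hg', rlIntegral_congr h _ hx]
  intro x hx
  have h1 := (hasDerivWithinAt_rlIntegral_one hf hx).derivWithin (uniqueDiffOn_Icc hab x hx)
  have h2 := (hasDerivWithinAt_rlIntegral_one hg hx).derivWithin (uniqueDiffOn_Icc hab x hx)
  rw [← h1, ← h2, derivWithin_congr key (key hx)]

theorem hasDerivWithinAt_rlIntegral_add_one {a b α : ℝ} (hα : 0 ≤ α) {f : ℝ → ℝ}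
    (hf : ContinuousOn f (Icc a b)) {x : ℝ} (hx : x ∈ Icc a b) :
    HasDerivWithinAt (rlIntegral a (α + 1) f) (rlIntegral a α f x) (Icc a b) x := by
  have h := rlIntegral_rlIntegral zero_le_one hα hf
  rw [add_comm] at h
  exact (hasDerivWithinAt_rlIntegral_one (continuousOn_rlIntegral hα hf) hx).congr
    (fun y hy => (h hy).symm) (h hx).symm

/-! ### Fractional Taylor expansions. -/

/-- The fractional Taylor expansion `∑_{j<N} c_j (x-a)^j / j! + J_a^α g (x)`. -/
noncomputable def fracTaylor (a : ℝ) (N : ℕ) (c : ℕ → ℝ) (α : ℝ) (g : ℝ → ℝ) (x : ℝ) : ℝ :=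
  ∑ j ∈ Finset.range N, c j / j.factorial * (x - a) ^ j + rlIntegral a α g x

theorem fracTaylor_self {a α : ℝ} (hα : 0 < α) {N : ℕ} (hN : 0 < N) (c : ℕ → ℝ) (g : ℝ → ℝ) :
    fracTaylor a N c α g a = c 0 := by
  obtain ⟨N, rfl⟩ := Nat.exists_eq_add_one.2 hN
  simp [fracTaylor, rlIntegral_self hα, Finset.sum_range_succ']

theorem continuousOn_fracTaylor {a b α : ℝ} (hα : 0 ≤ α) (N : ℕ) (c : ℕ → ℝ) {g : ℝ → ℝ}
    (hg : ContinuousOn g (Icc a b)) : ContinuousOn (fracTaylor a N c α g) (Icc a b) :=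
  ContinuousOn.add (by fun_prop) (continuousOn_rlIntegral hα hg)

/-- Raising the order by an integer moves a constant into the integrand. -/
theorem fracTaylor_succ {a b γ : ℝ} (hγ : 0 ≤ γ) (n : ℕ) (c : ℕ → ℝ) {g : ℝ → ℝ}
    (hg : ContinuousOn g (Icc a b)) {x : ℝ} (hx : x ∈ Icc a b) :
    fracTaylor a (n + 1) c (n + γ) g x =
      fracTaylor a n c n (fun t => c n + rlIntegral a γ g t) x := by
  rw [fracTaylor, fracTaylor, Finset.sum_range_succ,
    rlIntegral_add n.cast_nonneg continuousOn_const (continuousOn_rlIntegral hγ hg) hx,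
    rlIntegral_rlIntegral n.cast_nonneg hγ hg hx, rlIntegral_natCast_const]
  ring

theorem hasDerivWithinAt_fracTaylor {a b α : ℝ} (hα : 0 ≤ α) (N : ℕ) (c : ℕ → ℝ) {g : ℝ → ℝ}
    (hg : ContinuousOn g (Icc a b)) {x : ℝ} (hx : x ∈ Icc a b) :
    HasDerivWithinAt (fracTaylor a N c (α + 1) g)
      (fracTaylor a (N - 1) (fun j => c (j + 1)) α g x) (Icc a b) x := by
  refine HasDerivWithinAt.add ?_ (hasDerivWithinAt_rlIntegral_add_one hα hg hx)
  have h : HasDerivAt (fun x => ∑ j ∈ Finset.range N, c j / j.factorial * (x - a) ^ j)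
      (∑ j ∈ Finset.range N, c j / j.factorial * (j * (x - a) ^ (j - 1) * 1)) x :=
    HasDerivAt.fun_sum fun j _ =>
      (((hasDerivAt_id x).sub_const a).pow j).const_mul (c j / j.factorial)
  convert h.hasDerivWithinAt using 1
  rcases N with _ | N
  · simp
  · rw [Finset.sum_range_succ']
    simp only [Nat.add_sub_cancel, Nat.cast_zero, zero_mul, mul_zero, add_zero]
    refine Finset.sum_congr rfl fun j _ => ?_
    rw [Nat.factorial_succ]
    push_cast
    have : (j.factorial : ℝ) ≠ 0 := by positivity
    field_simp

/-- Each derivative lowers the order by one and shifts the coefficients. `N` is independent of `n`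
because the polynomial part may be empty; the truncated `N - k` covers the case where it runs out.
-/
theorem contDiffOn_of_eqOn_fracTaylor {a b : ℝ} (hab : a < b) {g : ℝ → ℝ}
    (hg : ContinuousOn g (Icc a b)) {α : ℝ} (hα : 0 ≤ α) (n : ℕ) :
    ∀ {N : ℕ} {c : ℕ → ℝ} {f : ℝ → ℝ}, EqOn f (fracTaylor a N c (α + n) g) (Icc a b) →
      ContDiffOn ℝ n f (Icc a b) ∧ ∀ k ≤ n, EqOn (iteratedDerivWithin k f (Icc a b))
        (fracTaylor a (N - k) (fun j => c (j + k)) (α + (n - k : ℕ)) g) (Icc a b) := by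
  induction n with
  | zero =>
    intro N c f hf
    refine ⟨contDiffOn_zero.2 ((continuousOn_fracTaylor (by simpa) N c hg).congr hf), ?_⟩
    intro k hk
    obtain rfl : k = 0 := by omega
    simpa using hf
  | succ n ih =>
    intro N c f hf
    have hd : ∀ x ∈ Icc a b, HasDerivWithinAt f
        (fracTaylor a (N - 1) (fun j => c (j + 1)) (α + n) g x) (Icc a b) x := by
      intro x hx
      have h := hasDerivWithinAt_fracTaylor (α := α + n) (by positivity) N c hg hx
      rw [show α + n + 1 = α + (n + 1 : ℕ) by push_cast; ring] at h
      exact h.congr hf (hf hx)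
    have hd' : EqOn (derivWithin f (Icc a b))
        (fracTaylor a (N - 1) (fun j => c (j + 1)) (α + n) g) (Icc a b) :=
      fun x hx => (hd x hx).derivWithin (uniqueDiffOn_Icc hab x hx)
    obtain ⟨h1, h2⟩ := ih hd'
    constructor
    · push_cast
      rw [contDiffOn_succ_iff_derivWithin (uniqueDiffOn_Icc hab)]
      exact ⟨fun x hx => (hd x hx).differentiableWithinAt, by simp, h1⟩
    · rintro (_ | k) hk
      · simpa using hf
      · rw [iteratedDerivWithin_succ']
        have := h2 k (by omega)
        simpa only [Nat.sub_sub, Nat.add_sub_add_right, add_assoc, add_comm 1 k] using this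

/-- Taylor's formula with integral remainder on `[a,b]`. -/
theorem eqOn_fracTaylor_of_contDiffOn {a b : ℝ} (hab : a < b) {f : ℝ → ℝ} (n : ℕ)
    (hf : ContDiffOn ℝ n f (Icc a b)) :
    EqOn f (fracTaylor a n (fun k => iteratedDerivWithin k f (Icc a b) a) n
      (iteratedDerivWithin n f (Icc a b))) (Icc a b) := by
  induction n with
  | zero => intro x _; simp [fracTaylor, rlIntegral_zero]
  | succ n ih =>
    intro x hx
    have hu := uniqueDiffOn_Icc hab
    have hc : ContinuousOn (iteratedDerivWithin (n + 1) f (Icc a b)) (Icc a b) :=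
      hf.continuousOn_iteratedDerivWithin le_rfl hu
    have hn : (n : WithTop ℕ∞) < (n + 1 : ℕ) := by exact_mod_cast n.lt_succ_self
    have hc' : ContinuousOn (iteratedDerivWithin n f (Icc a b)) (Icc a b) :=
      hf.continuousOn_iteratedDerivWithin hn.le hu
    have hd := hf.differentiableOn_iteratedDerivWithin hn hu
    -- The inductive step: `f^(n)` is a constant plus `J_a^1 f^(n+1)`, the form of integrand that
    -- `fracTaylor_succ` absorbs.
    have ftc : EqOn (iteratedDerivWithin n f (Icc a b)) (fun t => iteratedDerivWithin n f (Icc a b) a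
        + rlIntegral a 1 (iteratedDerivWithin (n + 1) f (Icc a b)) t) (Icc a b) := by
      intro y hy
      have hsub : Icc a y ⊆ Icc a b := Icc_subset_Icc_right hy.2
      have := intervalIntegral.integral_eq_sub_of_hasDerivAt_of_le hy.1 (hc'.mono hsub)
        (f' := iteratedDerivWithin (n + 1) f (Icc a b)) (fun t ht => by
          have htb : t < b := ht.2.trans_le hy.2
          rw [iteratedDerivWithin_succ]
          exact (hd t ⟨ht.1.le, htb.le⟩).hasDerivWithinAt.hasDerivAt (Icc_mem_nhds ht.1 htb))
        ((hc.mono hsub).intervalIntegrable_of_Icc hy.1)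
      simp only [rlIntegral_one, this]
      ring
    rw [Nat.cast_succ, fracTaylor_succ zero_le_one n _ hc hx, ih (hf.of_le hn.le) hx]
    simp only [fracTaylor]
    rw [rlIntegral_congr ftc n hx]

/-! ### Caputo differentiability as a fractional Taylor expansion. -/

theorem caputoRemainder_eq {a b α : ℝ} (hα : 0 < α) (f : ℝ → ℝ) (x : ℝ) :
    caputoRemainder a b α f x = f x - ∑ k ∈ Finset.range ⌈α⌉₊,
      iteratedDerivWithin k f (Icc a b) a / k.factorial * (x - a) ^ k := by
  have h : 0 < ⌈α⌉₊ := Nat.ceil_pos.2 hα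
  rw [caputoRemainder, taylor_within_apply, Nat.sub_add_cancel h]
  congr 1
  refine Finset.sum_congr rfl fun k _ => ?_
  rw [smul_eq_mul]
  ring

theorem caputoDeriv_eq {a b α : ℝ} (hα : 0 < α) (f : ℝ → ℝ) :
    caputoDeriv a b α f = iteratedDerivWithin ⌈α⌉₊
      (rlIntegral a ((⌈α⌉₊ : ℝ) - α) (caputoRemainder a b α f)) (Icc a b) := by
  simp [caputoDeriv, hα.ne', rlDeriv]

/-- A function with a fractional Taylor expansion of order `α` is continuously Caputo
`α`-differentiable, and the integrand of the remainder is its Caputo derivative. -/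
theorem contCaputoDifferentiable_of_eqOn_fracTaylor {a b α : ℝ} (hab : a < b) (hα : 0 < α)
    {f g : ℝ → ℝ} (hg : ContinuousOn g (Icc a b)) {c : ℕ → ℝ}
    (hf : EqOn f (fracTaylor a ⌈α⌉₊ c α g) (Icc a b)) :
    ContCaputoDifferentiable a b α f ∧ EqOn (caputoDeriv a b α f) g (Icc a b) := by
  obtain ⟨n, hn⟩ := Nat.exists_eq_add_one.2 (Nat.ceil_pos.2 hα)
  have hnα : (n : ℝ) < α := by
    have := Nat.lt_of_lt_of_eq (Nat.lt_succ_self n) hn.symm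
    exact Nat.lt_ceil.1 this
  have hm : α ≤ ⌈α⌉₊ := Nat.le_ceil α
  obtain ⟨h1, h2⟩ := contDiffOn_of_eqOn_fracTaylor hab hg (sub_nonneg.2 hnα.le) n
    (N := ⌈α⌉₊) (c := c) (f := f) (by rwa [sub_add_cancel])
  -- The order left after `k ≤ n < α` derivatives is positive, so the integral term vanishes at `a`
  -- and `c k` is the `k`-th derivative of `f` there.
  have hr : EqOn (caputoRemainder a b α f) (rlIntegral a α g) (Icc a b) := by
    intro x hx
    rw [caputoRemainder_eq hα, hf hx, fracTaylor, sub_eq_iff_eq_add']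
    congr 1
    refine Finset.sum_congr rfl fun k hk => ?_
    rw [Finset.mem_range] at hk
    rw [h2 k (by omega) (left_mem_Icc.2 hab.le), fracTaylor_self ?_ (by omega)]
    · simp
    · have : (0 : ℝ) ≤ (n - k : ℕ) := Nat.cast_nonneg _
      linarith
  -- Since `J_a^{m-α} J_a^α g = J_a^m g`, differentiating `m = ⌈α⌉` times returns `g`.
  have hF : EqOn (rlIntegral a ((⌈α⌉₊ : ℝ) - α) (caputoRemainder a b α f))
      (fracTaylor a 0 c (0 + (⌈α⌉₊ : ℕ)) g) (Icc a b) := by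
    intro x hx
    rw [rlIntegral_congr hr _ hx, rlIntegral_rlIntegral (sub_nonneg.2 hm) hα.le hg hx]
    simp [fracTaylor]
  obtain ⟨h3, h4⟩ := contDiffOn_of_eqOn_fracTaylor hab hg le_rfl _ hF
  refine ⟨⟨?_, (continuousOn_rlIntegral hα.le hg).congr hr, h3⟩, fun x hx => ?_⟩
  · rwa [hn, Nat.add_sub_cancel]
  · rw [caputoDeriv_eq hα, h4 _ le_rfl hx]
    simp [fracTaylor, rlIntegral_zero]

namespace ContCaputoDifferentiable

variable {a b α : ℝ} {f : ℝ → ℝ}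

theorem continuousOn_caputoDeriv (hab : a < b) (hα : 0 < α)
    (hf : ContCaputoDifferentiable a b α f) :
    ContinuousOn (caputoDeriv a b α f) (Icc a b) := by
  rw [caputoDeriv_eq hα]
  exact hf.2.2.continuousOn_iteratedDerivWithin le_rfl (uniqueDiffOn_Icc hab)

/-- A continuously Caputo `α`-differentiable function has a fractional Taylor expansion of
order `α`. -/
theorem eqOn_fracTaylor (hab : a < b) (hα : 0 < α) (hf : ContCaputoDifferentiable a b α f) :
    EqOn f (fracTaylor a ⌈α⌉₊ (fun k => iteratedDerivWithin k f (Icc a b) a) α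
      (caputoDeriv a b α f)) (Icc a b) := by
  obtain ⟨n, hn⟩ := Nat.exists_eq_add_one.2 (Nat.ceil_pos.2 hα)
  have hm : 0 ≤ (⌈α⌉₊ : ℝ) - α := sub_nonneg.2 (Nat.le_ceil α)
  have hm1 : (⌈α⌉₊ : ℝ) - α ≤ 1 := by linarith [Nat.ceil_lt_add_one hα.le]
  have hg := hf.continuousOn_caputoDeriv hab hα
  have ha : a ∈ Icc a b := left_mem_Icc.2 hab.le
  obtain ⟨hf1, hr, hF⟩ := hf
  rw [hn, Nat.add_sub_cancel] at hf1
  set s : ℝ → ℝ := fun t => iteratedDerivWithin n f (Icc a b) t -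
    iteratedDerivWithin n f (Icc a b) a with hs
  have hDc : ContinuousOn (iteratedDerivWithin n f (Icc a b)) (Icc a b) :=
    hf1.continuousOn_iteratedDerivWithin le_rfl (uniqueDiffOn_Icc hab)
  have hsc : ContinuousOn s (Icc a b) := hDc.sub continuousOn_const
  have hsa : s a = 0 := sub_self _
  -- Taylor's formula at order `n = m - 1`; subtracting the degree `n` term replaces `f^(n)` by `s`,
  -- which vanishes at `a`.
  have hrs : EqOn (caputoRemainder a b α f) (rlIntegral a n s) (Icc a b) := by
    intro x hx
    rw [caputoRemainder_eq hα, hs, rlIntegral_sub n.cast_nonneg hDc continuousOn_const hx,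
      rlIntegral_natCast_const, hn, Finset.sum_range_succ,
      eqOn_fracTaylor_of_contDiffOn hab n hf1 hx, fracTaylor]
    ring
  have hFs : EqOn (rlIntegral a ((⌈α⌉₊ : ℝ) - α) (caputoRemainder a b α f))
      (fracTaylor a 0 0 ((⌈α⌉₊ : ℝ) - α + n) s) (Icc a b) := by
    intro x hx
    rw [rlIntegral_congr hrs _ hx, rlIntegral_rlIntegral hm n.cast_nonneg hsc hx]
    simp [fracTaylor]
  -- The `k`-th derivative is `J_a^{m-α+n-k} s`. It vanishes at `a` for positive order; order zero
  -- occurs only for `α = m`, `k = n`, where `s a = 0` is needed.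
  have hF0 : ∀ k < ⌈α⌉₊, iteratedDerivWithin k (rlIntegral a ((⌈α⌉₊ : ℝ) - α)
      (caputoRemainder a b α f)) (Icc a b) a = 0 := by
    intro k hk
    rw [(contDiffOn_of_eqOn_fracTaylor hab hsc hm n hFs).2 k (by omega) ha]
    have h0 : 0 ≤ (⌈α⌉₊ : ℝ) - α + (n - k : ℕ) := by positivity
    rcases h0.eq_or_lt with h | h
    · simp [fracTaylor, ← h, rlIntegral_zero, hsa]
    · simp [fracTaylor, rlIntegral_self h]
  -- By `hF0`, Taylor's formula for `J_a^{m-α}` of the remainder has no polynomial part, so it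
  -- equals `J_a^m` of the Caputo derivative; then `J_a^{m-α}` is cancelled.
  have hr' : EqOn (caputoRemainder a b α f) (rlIntegral a α (caputoDeriv a b α f)) (Icc a b) := by
    refine eqOn_of_rlIntegral_eqOn hab hm hm1 hr (continuousOn_rlIntegral hα.le hg) ?_
    intro x hx
    rw [rlIntegral_rlIntegral hm hα.le hg hx, sub_add_cancel,
      eqOn_fracTaylor_of_contDiffOn hab _ hF hx, fracTaylor, Finset.sum_eq_zero, zero_add,
      caputoDeriv_eq hα]
    intro k hk
    rw [hF0 k (Finset.mem_range.1 hk)]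
    simp
  intro x hx
  rw [fracTaylor, ← hr' hx, caputoRemainder_eq hα]
  ring

end ContCaputoDifferentiable

/-! ### Changing the order, and composition. -/

/-- Lowering the order: a continuously Caputo `α`-differentiable function has a fractional
Taylor expansion of each order `0 < β < α`, whose integrand vanishes at `a` unless `β` is an
integer. -/
theorem ContCaputoDifferentiable.exists_fracTaylor_of_lt {a b α β : ℝ} {f : ℝ → ℝ} (hab : a < b)
    (hβ : 0 < β) (hβα : β < α) (hf : ContCaputoDifferentiable a b α f) :
    ∃ (c : ℕ → ℝ) (g : ℝ → ℝ), ContinuousOn g (Icc a b) ∧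
      EqOn f (fracTaylor a ⌈β⌉₊ c β g) (Icc a b) ∧ ((¬ ∃ n : ℕ, β = n) → g a = 0) := by
  have hα : 0 < α := hβ.trans hβα
  have hle : β ≤ ⌈β⌉₊ := Nat.le_ceil β
  -- With equal ceilings the integrand is `J_a^{α-β}` of the Caputo derivative. Otherwise `f` is
  -- `C^⌈β⌉`, and classical Taylor gives `J_a^{⌈β⌉-β} f^(⌈β⌉)`.
  rcases (Nat.ceil_mono hβα.le).eq_or_lt with h | h
  · have hg := hf.continuousOn_caputoDeriv hab hα
    have hδ : 0 < α - β := sub_pos.2 hβα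
    refine ⟨fun k => iteratedDerivWithin k f (Icc a b) a, _,
      continuousOn_rlIntegral hδ.le hg, fun x hx => ?_, fun _ => rlIntegral_self hδ _⟩
    rw [fracTaylor, rlIntegral_rlIntegral hβ.le hδ.le hg hx, add_sub_cancel, h]
    exact hf.eqOn_fracTaylor hab hα hx
  · have hf1 : ContDiffOn ℝ ⌈β⌉₊ f (Icc a b) :=
      hf.1.of_le (by exact_mod_cast Nat.le_sub_one_of_lt h)
    have hg := hf1.continuousOn_iteratedDerivWithin le_rfl (uniqueDiffOn_Icc hab)
    refine ⟨fun k => iteratedDerivWithin k f (Icc a b) a, _,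
      continuousOn_rlIntegral (sub_nonneg.2 hle) hg, fun x hx => ?_, fun hn => ?_⟩
    · rw [fracTaylor, rlIntegral_rlIntegral hβ.le (sub_nonneg.2 hle) hg hx, add_sub_cancel]
      exact eqOn_fracTaylor_of_contDiffOn hab _ hf1 hx
    · refine rlIntegral_self (sub_pos.2 (hle.lt_of_ne fun he => hn ⟨_, he⟩)) _

theorem ceil_eq_ceil_add_of_not_natCast {β γ : ℝ} (hβ : 0 < β) (hγ : 0 < γ)
    (h : ⌈β + γ⌉ - ⌊β⌋ = 1) (hn : ¬ ∃ n : ℕ, β = n) : ⌈β + γ⌉₊ = ⌈β⌉₊ := by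
  have h1 : ⌈β⌉ ≤ ⌈β + γ⌉ := Int.ceil_mono (by linarith)
  have h2 : ⌊β⌋ < ⌈β⌉ := by
    rw [Int.floor_lt]
    refine (Int.le_ceil β).lt_of_ne fun he => hn ⟨⌈β⌉₊, ?_⟩
    rw [natCast_ceil_eq_intCast_ceil hβ.le, ← he]
  have h3 : ⌈β + γ⌉ = ⌈β⌉ := by omega
  rw [← Int.ceil_toNat, ← Int.ceil_toNat, h3]

theorem ceil_natCast_add {γ : ℝ} (hγ : 0 < γ) (hγ1 : γ ≤ 1) (n : ℕ) : ⌈(n : ℝ) + γ⌉₊ = n + 1 := by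
  rw [Nat.ceil_eq_iff (by omega)]
  push_cast
  constructor <;> simp <;> linarith

theorem ceil_eq_one {γ : ℝ} (hγ : 0 < γ) (hγ1 : γ ≤ 1) : ⌈γ⌉₊ = 1 := by
  simpa using ceil_natCast_add hγ hγ1 0

theorem ContCaputoDifferentiable.caputoDeriv_caputoDeriv {a b β γ : ℝ} {f : ℝ → ℝ} (hab : a < b)
    (hβ : 0 < β) (hγ : 0 < γ) (hγ1 : γ ≤ 1) (h : ⌈β + γ⌉ - ⌊β⌋ = 1)
    (hf : ContCaputoDifferentiable a b (β + γ) f) :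
    ContCaputoDifferentiable a b γ (caputoDeriv a b β f) ∧
      EqOn (caputoDeriv a b γ (caputoDeriv a b β f)) (caputoDeriv a b (β + γ) f) (Icc a b) := by
  have hg := hf.continuousOn_caputoDeriv hab (add_pos hβ hγ)
  have hfe := hf.eqOn_fracTaylor hab (add_pos hβ hγ)
  set c : ℕ → ℝ := fun k => iteratedDerivWithin k f (Icc a b) a
  have hgc : ∀ d : ℝ, ContinuousOn
      (fun t => d + rlIntegral a γ (caputoDeriv a b (β + γ) f) t) (Icc a b) := fun d =>
    continuousOn_const.add (continuousOn_rlIntegral hγ.le hg)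
  -- As `⌈γ⌉ = 1`, an expansion of order `γ` has only a constant polynomial part: `c n` if `β = n`,
  -- and `0` otherwise.
  suffices ∃ d : ℝ, EqOn (caputoDeriv a b β f)
      (fun t => d + rlIntegral a γ (caputoDeriv a b (β + γ) f) t) (Icc a b) by
    obtain ⟨d, hd⟩ := this
    refine contCaputoDifferentiable_of_eqOn_fracTaylor hab hγ hg (c := fun _ => d) ?_
    intro x hx
    rw [hd hx, ceil_eq_one hγ hγ1]
    simp [fracTaylor]
  by_cases hn : ∃ n : ℕ, β = n
  · obtain ⟨n, rfl⟩ := hn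
    refine ⟨c n, (contCaputoDifferentiable_of_eqOn_fracTaylor hab hβ
      (hgc _) (c := c) fun x hx => ?_).2⟩
    rw [Nat.ceil_natCast, ← fracTaylor_succ hγ.le n c hg hx, ← ceil_natCast_add hγ hγ1]
    exact hfe hx
  · refine ⟨0, (contCaputoDifferentiable_of_eqOn_fracTaylor hab hβ
      (hgc _) (c := c) fun x hx => ?_).2⟩
    simp only [zero_add]
    rw [fracTaylor, rlIntegral_rlIntegral hβ.le hγ.le hg hx,
      ← ceil_eq_ceil_add_of_not_natCast hβ hγ h hn]
    exact hfe hx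

theorem ContCaputoDifferentiable.add_of_caputoDeriv {a b β γ : ℝ} {f : ℝ → ℝ} (hab : a < b)
    (hβ : 0 < β) (hγ : 0 < γ) (hγ1 : γ ≤ 1) (h : ⌈β + γ⌉ - ⌊β⌋ = 1)
    (hf : ContCaputoDifferentiable a b β f)
    (hf' : ContCaputoDifferentiable a b γ (caputoDeriv a b β f))
    (h0 : (¬ ∃ n : ℕ, β = n) → caputoDeriv a b β f a = 0) :
    ContCaputoDifferentiable a b (β + γ) f ∧
      EqOn (caputoDeriv a b γ (caputoDeriv a b β f)) (caputoDeriv a b (β + γ) f) (Icc a b) := by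
  set f₁ := caputoDeriv a b β f with hf₁
  have hg := hf'.continuousOn_caputoDeriv hab hγ
  set g := caputoDeriv a b γ f₁
  have hfe := hf.eqOn_fracTaylor hab hβ
  have hf₁e : EqOn f₁ (fun t => f₁ a + rlIntegral a γ g t) (Icc a b) := by
    intro x hx
    rw [hf'.eqOn_fracTaylor hab hγ hx, ceil_eq_one hγ hγ1]
    simp [fracTaylor, g]
  rw [← hf₁] at hfe
  set c : ℕ → ℝ := fun k => iteratedDerivWithin k f (Icc a b) a
  suffices ∃ d : ℕ → ℝ, EqOn f (fracTaylor a ⌈β + γ⌉₊ d (β + γ) g) (Icc a b) by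
    obtain ⟨d, hd⟩ := this
    obtain ⟨h1, h2⟩ := contCaputoDifferentiable_of_eqOn_fracTaylor hab (add_pos hβ hγ) hg hd
    exact ⟨h1, h2.symm⟩
  by_cases hn : ∃ n : ℕ, β = n
  · obtain ⟨n, rfl⟩ := hn
    -- Taking `f₁ a` as the new degree `n` coefficient avoids having to identify it with `f^(n)(a)`.
    refine ⟨Function.update c n (f₁ a), fun x hx => ?_⟩
    rw [ceil_natCast_add hγ hγ1, fracTaylor_succ hγ.le n _ hg hx, Function.update_self, hfe hx,
      Nat.ceil_natCast, fracTaylor, fracTaylor, rlIntegral_congr hf₁e _ hx]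
    congr 1
    refine Finset.sum_congr rfl fun k hk => ?_
    rw [Function.update_of_ne (Finset.mem_range.1 hk).ne]
  · refine ⟨c, fun x hx => ?_⟩
    have hf₁e' : EqOn f₁ (rlIntegral a γ g) (Icc a b) := fun t ht => by
      simpa only [h0 hn, zero_add] using hf₁e ht
    rw [ceil_eq_ceil_add_of_not_natCast hβ hγ h hn, hfe hx, fracTaylor, fracTaylor,
      rlIntegral_congr hf₁e' _ hx, rlIntegral_rlIntegral hβ.le hγ.le hg hx]

theorem theorem3p5 (a b : ℝ) (hab : a < b) :
    (∀ (α : ℝ) (f : ℝ → ℝ), 0 < α → ContCaputoDifferentiable a b α f →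
      ∀ β : ℝ, 0 < β → β < α →
        (ContCaputoDifferentiable a b β f ∧
          ContinuousOn (caputoDeriv a b β f) (Set.Icc a b) ∧
          ((¬ ∃ n : ℕ, β = n) → caputoDeriv a b β f a = 0)) ∧
        (∀ γ : ℝ, 0 < γ → γ ≤ 1 → β + γ ≤ α → ⌈β + γ⌉ - ⌊β⌋ = 1 →
          ContCaputoDifferentiable a b γ (caputoDeriv a b β f) ∧
          Set.EqOn (caputoDeriv a b γ (caputoDeriv a b β f)) (caputoDeriv a b (β + γ) f)
            (Set.Icc a b))) ∧
    (∀ (β γ : ℝ) (h : ℝ → ℝ), 0 < β → 0 < γ → γ ≤ 1 → ⌈β + γ⌉ - ⌊β⌋ = 1 →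
      ContCaputoDifferentiable a b β h →
      ContCaputoDifferentiable a b γ (caputoDeriv a b β h) →
      ((¬ ∃ n : ℕ, β = n) → caputoDeriv a b β h a = 0) →
        ContCaputoDifferentiable a b (β + γ) h ∧
        Set.EqOn (caputoDeriv a b γ (caputoDeriv a b β h)) (caputoDeriv a b (β + γ) h)
          (Set.Icc a b)) := by
  refine ⟨fun α f hα hf β hβ hβα => ⟨?_, fun γ hγ hγ1 hβγ hceil => ?_⟩,
    fun β γ h hβ hγ hγ1 hceil hh hh' h0 =>
      hh.add_of_caputoDeriv hab hβ hγ hγ1 hceil hh' h0⟩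
  · obtain ⟨c, g, hg, hfg, h0⟩ := hf.exists_fracTaylor_of_lt hab hβ hβα
    obtain ⟨h1, h2⟩ := contCaputoDifferentiable_of_eqOn_fracTaylor hab hβ hg hfg
    exact ⟨h1, hg.congr h2, fun hn => (h2 (left_mem_Icc.2 hab.le)).trans (h0 hn)⟩
  · refine ContCaputoDifferentiable.caputoDeriv_caputoDeriv hab hβ hγ hγ1 hceil ?_
    rcases hβγ.eq_or_lt with rfl | hlt
    · exact hf
    · obtain ⟨c, g, hg, hfg, _⟩ := hf.exists_fracTaylor_of_lt hab (add_pos hβ hγ) hlt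
      exact (contCaputoDifferentiable_of_eqOn_fracTaylor hab (add_pos hβ hγ) hg hfg).1
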